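/- Let $p(x,y,z)=(x,y)$ and $h(x,y,z)=z$ on $\mathbb R^3$, and let $\mathcal K$ be the set of all oriented tame knot types in $\mathbb R^3$ (ambient isotopy classes of oriented knots that contain a polygonal knot; a knot is polygonal if it is a union of finitely many straight line segments). Let $f:\mathbb R\to\mathbb R$ be piecewise linear, i.e. $\mathbb R$ is a locally finite union of closed intervals (possibly unbounded) on each of which $f$ is affine, and put $\tilde f(x,y,z)=(x,y,f(z))$. Let $k$ be an oriented polygonal knot in $\mathbb R^3$ that is iteratively injective with respect to $\tilde f$, i.e. $\tilde f^{\,n}|_k$ is injective for every $n\ge 0$. Write $k_n=\tilde f^{\,n}(k)$, with the orientation pushed forward from $k$. Say that finitely many pairs $(x_1,y_1),\dots,(x_a,y_a)$ (with $a\ge 0$) of points of $k$, with $x_i\ne y_i$ and $p(x_i)=p(y_i)$ for each $i$, control the crossings if the following holds for all $0\le m\le n$: if for each $i$ the numbers $h(\tilde f^{\,m}(x_i))-h(\tilde f^{\,m}(y_i))$ and $h(\tilde f^{\,n}(x_i))-h(\tilde f^{\,n}(y_i))$ are both positive or both negative, then $$(h(u)-h(v))\,\bigl(h(\tilde f^{\,n-m}(u))-h(\tilde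 f^{\,n-m}(v))\bigr)>0$$ for all $u,v\in k_m$ with $u\neq v$ and $p(u)=p(v)$. Then every $k_n$ is an oriented polygonal knot; there exist finitely many pairs of points of $k$ that control the crossings; and whenever $a$ pairs of points of $k$ control the crossings, there is a finite subset $\mathcal J\subseteq\mathcal K$ with at most $2^a$ elements such that the knot type of $k_n$ belongs to $\mathcal J$ for every $n\ge 0$. In particular, the knot types of the iterates $k_n$ all lie in a finite subset of $\mathcal K$. -/

import Mathlib

noncomputable section

/-- Euclidean 3-space, with coordinates `v 0`, `v 1`, `v 2`. -/
abbrev R3 : Type := EuclideanSpace ℝ (Fin 3)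

/-- An oriented knot in `ℝ³`, given by a parametrization: an injective continuous map from the
circle `ℝ / ℤ`, oriented by increasing parameter. Parametrizations that differ by an
orientation-preserving homeomorphism of the circle are identified in `AmbientIsotopic` below. -/
structure OrientedKnot where
  /-- the parametrization -/
  toFun : UnitAddCircle → R3
  continuous_toFun : Continuous toFun
  injective_toFun : Function.Injective toFun

namespace OrientedKnot

/-- The underlying subset of `ℝ³`. -/
def carrier (k : OrientedKnot) : Set R3 := Set.range k.toFun

/-- A knot is polygonal if it is a union of finitely many straight line segments. -/
def IsPolygonal (k : OrientedKnot) : Prop :=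
  ∃ S : Finset (R3 × R3), k.carrier = ⋃ e ∈ S, segment ℝ e.1 e.2

/-- The image of an oriented knot under a continuous map that is injective on the knot, with the
orientation pushed forward. -/
def map (k : OrientedKnot) (g : R3 → R3) (hg : Continuous g) (hi : Set.InjOn g k.carrier) :
    OrientedKnot where
  toFun := g ∘ k.toFun
  continuous_toFun := hg.comp k.continuous_toFun
  injective_toFun := fun s t h =>
    k.injective_toFun (hi (Set.mem_range_self s) (Set.mem_range_self t) h)

/-- Two oriented knots are ambient isotopic if there is an isotopy `Φ t`, `0 ≤ t ≤ 1`, of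
homeomorphisms of `ℝ³` starting at the identity such that `Φ 1` maps the first knot onto the second
one and respects the orientations. An increasing bijection `g` of `ℝ` with `g (t + 1) = g t + 1` is
a lift of an orientation-preserving homeomorphism of the circle. -/
def AmbientIsotopic (k₁ k₂ : OrientedKnot) : Prop :=
  ∃ Φ : unitInterval → (R3 ≃ₜ R3),
    Continuous (fun q : unitInterval × R3 => Φ q.1 q.2) ∧
    (∀ v, Φ 0 v = v) ∧
    ∃ g : ℝ ≃o ℝ, (∀ t, g (t + 1) = g t + 1) ∧
      ∀ t : ℝ, Φ 1 (k₁.toFun (t : UnitAddCircle)) = k₂.toFun ((g t : ℝ) : UnitAddCircle)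

theorem AmbientIsotopic.refl (k : OrientedKnot) : AmbientIsotopic k k :=
  ⟨fun _ => Homeomorph.refl R3, continuous_snd, fun _ => rfl, OrderIso.refl ℝ,
    fun _ => rfl, fun _ => rfl⟩

theorem AmbientIsotopic.symm {k₁ k₂ : OrientedKnot} (h : AmbientIsotopic k₁ k₂) :
    AmbientIsotopic k₂ k₁ := by
  obtain ⟨Φ, hΦ, h0, g, hg, hk⟩ := h
  refine ⟨fun t => (Φ 1).symm.trans (Φ (unitInterval.symm t)), ?_, ?_, g.symm, ?_, ?_⟩
  · have : Continuous (fun q : unitInterval × R3 => (unitInterval.symm q.1, (Φ 1).symm q.2)) := by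
      fun_prop
    exact hΦ.comp this
  · intro v
    simp
  · intro t
    apply g.injective
    rw [hg]
    simp
  · intro t
    have h1 := hk (g.symm t)
    rw [OrderIso.apply_symm_apply] at h1
    simp [← h1, h0]

theorem AmbientIsotopic.trans {k₁ k₂ k₃ : OrientedKnot} (h : AmbientIsotopic k₁ k₂)
    (h' : AmbientIsotopic k₂ k₃) : AmbientIsotopic k₁ k₃ := by
  obtain ⟨Φ, hΦ, h0, g, hg, hk⟩ := h
  obtain ⟨Ψ, hΨ, h0', g', hg', hk'⟩ := h'
  refine ⟨fun t => (Φ t).trans (Ψ t), ?_, ?_, g.trans g', ?_, ?_⟩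
  · exact hΨ.comp (continuous_fst.prodMk hΦ)
  · intro v
    simp [h0, h0']
  · intro t
    simp [hg, hg']
  · intro t
    simp [hk, hk']

/-- Ambient isotopy is an equivalence relation on oriented knots. -/
instance isotopySetoid : Setoid OrientedKnot where
  r := AmbientIsotopic
  iseqv := ⟨AmbientIsotopic.refl, AmbientIsotopic.symm, AmbientIsotopic.trans⟩

end OrientedKnot

/-- An oriented knot type: an ambient isotopy class of oriented knots. -/
def KnotType : Type := Quotient OrientedKnot.isotopySetoid

/-- The oriented knot type of an oriented knot. -/
def OrientedKnot.knotType (k : OrientedKnot) : KnotType :=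
  Quotient.mk OrientedKnot.isotopySetoid k

/-- The set of all oriented tame knot types: the classes that contain a polygonal knot. -/
def tameKnotTypes : Set KnotType :=
  {K | ∃ k : OrientedKnot, k.IsPolygonal ∧ k.knotType = K}

/-- `f : ℝ → ℝ` is piecewise linear if `ℝ` is a locally finite union of closed intervals (possibly
unbounded) on each of which `f` is affine. -/
def IsPiecewiseLinear (f : ℝ → ℝ) : Prop :=
  ∃ (Λ : Type) (I : Λ → Set ℝ), LocallyFinite I ∧ (⋃ l, I l) = Set.univ ∧
    ∀ l, IsClosed (I l) ∧ (I l).OrdConnected ∧ ∃ α β : ℝ, ∀ z ∈ I l, f z = α * z + β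

theorem IsPiecewiseLinear.continuous {f : ℝ → ℝ} (hf : IsPiecewiseLinear f) : Continuous f := by
  obtain ⟨Λ, I, hI, hU, h⟩ := hf
  refine hI.continuous hU (fun l => (h l).1) (fun l => ?_)
  obtain ⟨α, β, hαβ⟩ := (h l).2.2
  have hc : Continuous (fun z : ℝ => α * z + β) := by fun_prop
  exact hc.continuousOn.congr hαβ

/-- The map `(x, y, z) ↦ (x, y, f z)`. -/
def tildeMap (f : ℝ → ℝ) (v : R3) : R3 := !₂[v 0, v 1, f (v 2)]

theorem continuous_tildeMap {f : ℝ → ℝ} (hf : Continuous f) : Continuous (tildeMap f) := by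
  refine (PiLp.continuous_toLp 2 _).comp (continuous_pi fun i => ?_)
  fin_cases i
  · exact (by fun_prop : Continuous fun v : R3 => v 0)
  · exact (by fun_prop : Continuous fun v : R3 => v 1)
  · exact (by fun_prop : Continuous fun v : R3 => f (v 2))

/-- The projection `(x, y, z) ↦ (x, y)`. -/
def planeProj (v : R3) : EuclideanSpace ℝ (Fin 2) := !₂[v 0, v 1]

/-- The height function `(x, y, z) ↦ z`. -/
def height (v : R3) : ℝ := v 2

/-- `A` is iteratively injective with respect to `F` if every iterate of `F` is injective on `A`. -/
def IterativelyInjective {X : Type*} (F : X → X) (A : Set X) : Prop :=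
  ∀ n : ℕ, Set.InjOn (F^[n]) A

/-- The oriented knot `F^n(k)`. -/
def OrientedKnot.iterImage (k : OrientedKnot) (F : R3 → R3) (hF : Continuous F)
    (hk : IterativelyInjective F k.carrier) (n : ℕ) : OrientedKnot :=
  k.map (F^[n]) (hF.iterate n) (hk n)

/-- The pairs `(x i, y i)`, `i < a`, of distinct points of `A`, each with a common projection to the
plane, control the crossings of the iterated images `A_m = F^m(A)`: whenever `m ≤ n` and for each
`i` the height differences of `(F^m (x i), F^m (y i))` and `(F^n (x i), F^n (y i))` have the same
sign, the map `F^(n-m)` from `A_m` to `A_n` preserves the sign of the height difference of any two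
distinct points of `A_m` with a common projection. -/
def ControlsCrossings (F : R3 → R3) (A : Set R3) {a : ℕ} (x y : Fin a → R3) : Prop :=
  (∀ i, x i ∈ A ∧ y i ∈ A ∧ x i ≠ y i ∧ planeProj (x i) = planeProj (y i)) ∧
  ∀ m n : ℕ, m ≤ n →
    (∀ i, 0 < (height (F^[m] (x i)) - height (F^[m] (y i))) *
        (height (F^[n] (x i)) - height (F^[n] (y i)))) →
    ∀ u ∈ F^[m] '' A, ∀ v ∈ F^[m] '' A, u ≠ v → planeProj u = planeProj v →
      0 < (height u - height v) * (height (F^[n - m] u) - height (F^[n - m] v))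

end

/-!
The map `tildeMap f` moves points vertically only, so `k_m` and `k_n` have the same projection to the
plane. If `m ≤ n` and the map from `k_m` to `k_n` keeps the vertical order of any two points on a
common vertical line, then moving every point of `k_m` along the vertical segment to its image is an
isotopy of knots. It extends to an ambient isotopy: the height function of `k_n`, transported to
`k_m`, extends to a continuous function `H` on `ℝ³` that is an increasing bijection on every
vertical line (`exists_fiberwise_strictMono_extension`), and `(w, z) ↦ (w, (1 - t) z + t H (w, z))`
is a homeomorphism for every `t ∈ [0, 1]`
(`OrientedKnot.ambientIsotopic_of_toFun_eq_tildeMap`). This step needs only that the knot is compact.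

The extension is of McShane type: `H q` is the supremum over `u` in the compact set of
`φ u - P (q, u)`, where the penalty `P` depends on the horizontal distance and strictly increases with
the height difference. Such a `P` exists because on a compact space every continuous function that
is nonpositive on the zero set of `e ≥ 0` is dominated by an increasing function of `e`
(`exists_orderIso_modulus`); this is used once to bound vertical differences of `φ` from below and
once to absorb the remaining error.

If pairs of points control the crossings, the vector of signs of the height differences of the
pairs in `k_n` takes at most `2 ^ a` values, and it determines the knot type of `k_n`. Controlling
pairs exist because the set of pairs of distinct points of a polygonal knot with equal projection is
a finite union of convex sets (`IsPolygonalSet.exists_finite_convex_cover`), and by iterative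
injectivity the sign of every iterated height difference is constant on each of them: one pair from
each convex set suffices.
-/

open Set Filter Topology

/-! ### Monotone extension from a compact set -/

/-- On a compact space, a continuous function that is nonpositive where `e ≥ 0` vanishes is bounded
by an increasing function of `e` vanishing at `0`. Making that function an order isomorphism of `ℝ`
provides its continuity and a continuous inverse. -/
theorem exists_orderIso_modulus {X : Type*} [TopologicalSpace X] [CompactSpace X] {c e : X → ℝ}
    (hc : Continuous c) (he : Continuous e) (he0 : ∀ x, 0 ≤ e x) (hce : ∀ x, e x = 0 → c x ≤ 0) :
    ∃ N : ℝ ≃o ℝ, N 0 = 0 ∧ ∀ x, c x ≤ N (e x) := by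
  -- `N r = r + sup_x F r x`; where `e x = 0` the division gives `0`, which is the right value
  -- because `max (c x) 0` vanishes there
  set F : ℝ → X → ℝ := fun r x => max (c x) 0 * min 1 (max r 0 / e x) with hF
  have hmin0 : ∀ r x, 0 ≤ min 1 (max r 0 / e x) := fun r x =>
    le_min zero_le_one (div_nonneg (le_max_right _ _) (he0 x))
  have hF0 : ∀ r x, 0 ≤ F r x := fun r x => mul_nonneg (le_max_right _ _) (hmin0 r x)
  have hFc : ∀ r x, F r x ≤ max (c x) 0 := fun r x =>
    mul_le_of_le_one_right (le_max_right _ _) (min_le_left _ _)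
  have hFmono : ∀ x, Monotone fun r => F r x := fun x r s hrs =>
    mul_le_mul_of_nonneg_left (min_le_min le_rfl
      (div_le_div_of_nonneg_right (max_le_max hrs le_rfl) (he0 x))) (le_max_right _ _)
  have hFcont : Continuous ↿F := by
    refine continuous_iff_continuousAt.2 fun ⟨r, x⟩ => ?_
    by_cases hx : e x = 0
    · have hcx : max (c x) 0 = 0 := max_eq_right (hce x hx)
      have hval : F r x = 0 := le_antisymm ((hFc r x).trans hcx.le) (hF0 r x)
      have hlim : Tendsto (fun q : ℝ × X => max (c q.2) 0) (𝓝 (r, x)) (𝓝 0) := by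
        have h : Continuous fun q : ℝ × X => max (c q.2) 0 := by fun_prop
        simpa [hcx] using h.tendsto (r, x)
      change Tendsto (fun q : ℝ × X => F q.1 q.2) (𝓝 (r, x)) (𝓝 (F r x))
      rw [hval]
      exact squeeze_zero (fun q => hF0 _ _) (fun q => hFc _ _) hlim
    · have h1 : ContinuousAt (fun q : ℝ × X => max q.1 0 / e q.2) (r, x) :=
        ContinuousAt.div (by fun_prop) (by fun_prop) hx
      have h2 : ContinuousAt (fun q : ℝ × X => max (c q.2) 0) (r, x) := by fun_prop
      exact h2.mul (continuousAt_const.min h1)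
  have hScont : Continuous fun r => sSup (F r '' univ) := isCompact_univ.continuous_sSup hFcont
  have hbdd : ∀ r, BddAbove (F r '' univ) := fun r =>
    (isCompact_univ.image (hFcont.comp (Continuous.prodMk_right r))).bddAbove
  have hS0 : ∀ r, 0 ≤ sSup (F r '' univ) := fun r =>
    Real.sSup_nonneg (by rintro _ ⟨x, -, rfl⟩; exact hF0 r x)
  have hSneg : ∀ r ≤ 0, sSup (F r '' univ) = 0 := fun r hr =>
    le_antisymm (Real.sSup_nonpos (by rintro _ ⟨x, -, rfl⟩; simp [hF, max_eq_right hr])) (hS0 r)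
  have hSmono : Monotone fun r => sSup (F r '' univ) := by
    intro r s hrs
    refine Real.sSup_le ?_ (hS0 s)
    rintro _ ⟨x, -, rfl⟩
    exact (hFmono x hrs).trans (le_csSup (hbdd s) ⟨x, mem_univ _, rfl⟩)
  have hmono : StrictMono fun r => r + sSup (F r '' univ) := strictMono_id.add_monotone hSmono
  have hsurj : Function.Surjective fun r => r + sSup (F r '' univ) := by
    refine Continuous.surjective (continuous_id.add hScont) ?_ ?_
    · exact tendsto_atTop_mono (fun r => le_add_of_nonneg_right (hS0 r)) tendsto_id
    · refine tendsto_id.congr' ?_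
      filter_upwards [eventually_le_atBot 0] with r hr
      rw [hSneg r hr, add_zero, id]
  refine ⟨hmono.orderIsoOfSurjective _ hsurj, ?_, fun x => ?_⟩
  · change 0 + sSup (F 0 '' univ) = 0
    rw [hSneg 0 le_rfl, add_zero]
  · have hx : c x ≤ F (e x) x := by
      rcases (he0 x).eq_or_lt with h | h
      · exact (hce x h.symm).trans (hF0 _ _)
      · simp [hF, max_eq_left h.le, div_self h.ne']
    calc c x ≤ F (e x) x := hx
      _ ≤ sSup (F (e x) '' univ) := le_csSup (hbdd _) ⟨x, mem_univ _, rfl⟩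
      _ ≤ e x + sSup (F (e x) '' univ) := le_add_of_nonneg_left (he0 x)

/-- A continuous function on a compact subset of `W × ℝ` that is strictly increasing on the fibres
over `W` extends to a continuous function whose restriction to every fibre is an increasing bijection
of `ℝ`. -/
theorem exists_fiberwise_strictMono_extension {W : Type*} [MetricSpace W] {K : Set (W × ℝ)}
    (hK : IsCompact K) (hne : K.Nonempty) {φ : K → ℝ} (hφ : Continuous φ)
    (hmono : ∀ u v : K, u.1.1 = v.1.1 → u.1.2 < v.1.2 → φ u < φ v) :
    ∃ H : W × ℝ → ℝ, Continuous H ∧ (∀ w, StrictMono fun z => H (w, z)) ∧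
      (∀ w, Function.Surjective fun z => H (w, z)) ∧ ∀ u : K, H u = φ u := by
  have : CompactSpace K := isCompact_iff_compactSpace.1 hK
  obtain ⟨u₀⟩ : Nonempty K := hne.to_subtype
  have hcongr : ∀ u v : K, u.1.1 = v.1.1 → u.1.2 = v.1.2 → u = v := fun u v h1 h2 =>
    Subtype.ext (Prod.ext h1 h2)
  -- On a common fibre, `N.symm` of a height difference bounds the difference of `φ` from below.
  let Z : Set (K × K) := {x | x.1.1.1 = x.2.1.1 ∧ x.1.1.2 ≤ x.2.1.2}
  have hZ : IsClosed Z :=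
    (isClosed_eq (f := fun x : K × K => x.1.1.1) (by fun_prop) (by fun_prop)).inter
      (isClosed_le (f := fun x : K × K => x.1.1.2) (by fun_prop) (by fun_prop))
  have : CompactSpace Z := isCompact_iff_compactSpace.1 hZ.isCompact
  obtain ⟨N, hN0, hN⟩ := exists_orderIso_modulus (X := Z)
    (c := fun x => x.1.2.1.2 - x.1.1.1.2) (e := fun x => φ x.1.2 - φ x.1.1)
    (by fun_prop) (by fun_prop)
    (fun x => by
      rcases x.2.2.eq_or_lt with h | h
      · simp [hcongr _ _ x.2.1 h]
      · exact sub_nonneg.2 (hmono _ _ x.2.1 h).le)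
    (fun x hx => by
      rcases x.2.2.eq_or_lt with h | h
      · simp [h]
      · exact absurd (hmono _ _ x.2.1 h) (by linarith))
  have hNs0 : N.symm 0 = 0 := by rw [OrderIso.symm_apply_eq, hN0]
  have hNc : Continuous N.symm := N.symm.continuous
  -- The lower bound by `N.symm` persists for points on different fibres up to an error that is
  -- controlled by the horizontal distance and the upward height difference.
  obtain ⟨N', hN'0, hN'⟩ := exists_orderIso_modulus (X := K × K)
    (c := fun x => φ x.1 - φ x.2 + N.symm (max (x.2.1.2 - x.1.1.2) 0))
    (e := fun x => dist x.1.1.1 x.2.1.1 + max (x.1.1.2 - x.2.1.2) 0)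
    (by fun_prop) (by fun_prop) (fun x => by positivity)
    (fun x hx => by
      obtain ⟨h1, h2⟩ := (add_eq_zero_iff_of_nonneg dist_nonneg (le_max_right _ _)).1 hx
      have h3 : x.1.1.2 ≤ x.2.1.2 := sub_nonpos.1 (max_eq_right_iff.1 h2)
      have h4 := hN ⟨x, dist_eq_zero.1 h1, h3⟩
      rw [max_eq_left (sub_nonneg.2 h3)]
      have h5 := N.symm.monotone h4
      rw [OrderIso.symm_apply_apply] at h5
      simp only at h5
      linarith)
  have hN'c : Continuous N' := N'.continuous
  -- the penalty: `r` is the horizontal distance, `d` the height difference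
  let P : ℝ → ℝ → ℝ := fun r d => N' (r + max d 0) - N.symm (max (-d) 0)
  have hPmono : ∀ r, StrictMono (P r) := by
    intro r d₁ d₂ hd
    rcases le_or_gt d₂ 0 with h | h
    · have h1 : N' (r + max d₁ 0) ≤ N' (r + max d₂ 0) := N'.monotone (by gcongr)
      have h2 : N.symm (max (-d₂) 0) < N.symm (max (-d₁) 0) := N.symm.strictMono (by
        rw [max_eq_left (by linarith), max_eq_left (by linarith)]
        linarith)
      simp only [P]
      linarith
    · have h1 : N' (r + max d₁ 0) < N' (r + max d₂ 0) := N'.strictMono (by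
        rw [max_eq_left h.le]
        gcongr
        exact max_lt hd h)
      have h2 : N.symm (max (-d₂) 0) ≤ N.symm (max (-d₁) 0) := N.symm.monotone (by gcongr)
      simp only [P]
      linarith
  let F : W × ℝ → K → ℝ := fun q u => φ u - P (dist u.1.1 q.1) (u.1.2 - q.2)
  have hFcont : Continuous ↿F := by
    change Continuous fun x : (W × ℝ) × K => φ x.2 -
      (N' (dist x.2.1.1 x.1.1 + max (x.2.1.2 - x.1.2) 0) - N.symm (max (-(x.2.1.2 - x.1.2)) 0))
    fun_prop
  have hFq : ∀ q, Continuous (F q) := fun q => hFcont.comp (Continuous.prodMk_right q)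
  let H : W × ℝ → ℝ := fun q => sSup (F q '' univ)
  have hHcont : Continuous H := isCompact_univ.continuous_sSup hFcont
  have hle : ∀ q u, F q u ≤ H q := fun q u =>
    le_csSup (isCompact_univ.image (hFq q)).bddAbove ⟨u, mem_univ _, rfl⟩
  have hmax : ∀ q, ∃ u, H q = F q u := fun q => by
    obtain ⟨u, -, hu⟩ := isCompact_univ.exists_sSup_image_eq ⟨u₀, mem_univ _⟩ (hFq q).continuousOn
    exact ⟨u, hu⟩
  refine ⟨H, hHcont, fun w z₁ z₂ hz => ?_, fun w => ?_, fun u => le_antisymm ?_ ?_⟩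
  · obtain ⟨u, hu⟩ := hmax (w, z₁)
    refine lt_of_eq_of_lt hu (lt_of_lt_of_le ?_ (hle (w, z₂) u))
    exact sub_lt_sub_left (hPmono _ (sub_lt_sub_left hz _)) _
  · refine Continuous.surjective (by fun_prop) ?_ ?_
    · refine tendsto_atTop_mono' _ (f₁ := fun z => φ u₀ - N' (dist u₀.1.1 w) + N.symm (z - u₀.1.2))
        ?_ (tendsto_atTop_add_const_left _ _
          (N.symm.tendsto_atTop.comp (tendsto_atTop_add_const_right _ _ tendsto_id)))
      filter_upwards [eventually_ge_atTop u₀.1.2] with z hz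
      refine le_trans (le_of_eq ?_) (hle (w, z) u₀)
      simp only [F, P]
      rw [max_eq_right (sub_nonpos.2 hz), neg_sub, max_eq_left (sub_nonneg.2 hz), add_zero]
      ring
    · obtain ⟨B, hB⟩ := (isCompact_univ.image hφ).bddAbove
      obtain ⟨C, hC⟩ := (isCompact_univ.image
        (by fun_prop : Continuous fun u : K => u.1.2)).bddBelow
      refine tendsto_atBot_mono' _ (f₁ := fun z => B + -N' (C - z)) ?_
        (tendsto_atBot_add_const_left _ _ (tendsto_neg_atTop_atBot.comp
          (N'.tendsto_atTop.comp (tendsto_atTop_add_const_left _ _ tendsto_neg_atBot_atTop))))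
      filter_upwards [eventually_le_atBot C] with z hz
      obtain ⟨u, hu⟩ := hmax (w, z)
      have h1 : φ u ≤ B := hB ⟨u, mem_univ _, rfl⟩
      have h2 : C ≤ u.1.2 := hC ⟨u, mem_univ _, rfl⟩
      have h3 : N' (C - z) ≤ N' (dist u.1.1 w + (u.1.2 - z)) := N'.monotone (by
        have := dist_nonneg (x := u.1.1) (y := w)
        linarith)
      change H (w, z) ≤ _
      rw [hu]
      simp only [F, P]
      rw [max_eq_left (by linarith), max_eq_right (by linarith), hNs0]
      linarith
  · obtain ⟨v, hv⟩ := hmax u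
    have h := hN' (v, u)
    rw [hv]
    simp only [F, P, neg_sub]
    simp only at h
    linarith
  · refine le_trans (le_of_eq ?_) (hle u u)
    simp [F, P, hN'0, hNs0]

/-! ### Homeomorphisms that preserve vertical lines -/

theorem continuous_fiberwise_inverse {W : Type*} [TopologicalSpace W] {H G : W × ℝ → ℝ}
    (hH : Continuous H) (hmono : ∀ w, StrictMono fun z => H (w, z))
    (hG : ∀ w y, H (w, G (w, y)) = y) : Continuous G := by
  refine continuous_iff_continuousAt.2 fun ⟨w, y⟩ => ?_
  refine tendsto_order.2 ⟨fun a ha => ?_, fun a ha => ?_⟩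
  · have h : H (w, a) < y := (hmono w ha).trans_eq (hG w y)
    have h' : ∀ᶠ q : W × ℝ in 𝓝 (w, y), H (q.1, a) < q.2 :=
      (isOpen_lt (by fun_prop) (by fun_prop)).mem_nhds h
    filter_upwards [h'] with q hq
    exact (hmono q.1).lt_iff_lt.1 (hq.trans_eq (hG q.1 q.2).symm)
  · have h : y < H (w, a) := (hG w y).symm.trans_lt (hmono w ha)
    have h' : ∀ᶠ q : W × ℝ in 𝓝 (w, y), q.2 < H (q.1, a) :=
      (isOpen_lt (by fun_prop) (by fun_prop)).mem_nhds h
    filter_upwards [h'] with q hq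
    exact (hmono q.1).lt_iff_lt.1 ((hG q.1 q.2).trans_lt hq)

/-- The homeomorphism `(w, z) ↦ (w, H (w, z))` of `W × ℝ`, for `H` continuous and an increasing
bijection on every fibre `{w} × ℝ`. -/
noncomputable def fiberwiseHomeomorph {W : Type*} [TopologicalSpace W] (H : W × ℝ → ℝ) (hH : Continuous H)
    (hmono : ∀ w, StrictMono fun z => H (w, z))
    (hsurj : ∀ w, Function.Surjective fun z => H (w, z)) : W × ℝ ≃ₜ W × ℝ where
  toFun q := (q.1, H q)
  invFun q := (q.1, Function.surjInv (hsurj q.1) q.2)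
  left_inv q := Prod.ext rfl ((hmono q.1).injective (Function.surjInv_eq (hsurj q.1) _))
  right_inv q := Prod.ext rfl (Function.surjInv_eq (hsurj q.1) q.2)
  continuous_toFun := by fun_prop
  continuous_invFun := continuous_fst.prodMk (continuous_fiberwise_inverse hH hmono
    (G := fun q => Function.surjInv (hsurj q.1) q.2) fun w y => Function.surjInv_eq (hsurj w) y)

/-! ### Plane and height coordinates -/

theorem R3.ext_planeProj_height {u v : R3} (h : planeProj u = planeProj v)
    (h' : height u = height v) : u = v := by
  have h0 := congrArg (fun w => w 0) h
  have h1 := congrArg (fun w => w 1) h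
  ext i
  fin_cases i
  · simpa [planeProj] using h0
  · simpa [planeProj] using h1
  · exact h'

theorem continuous_planeProj : Continuous planeProj := by
  refine (PiLp.continuous_toLp 2 _).comp (continuous_pi fun i => ?_)
  fin_cases i
  · exact (by fun_prop : Continuous fun v : R3 => v 0)
  · exact (by fun_prop : Continuous fun v : R3 => v 1)

theorem continuous_height : Continuous height := by
  unfold height
  fun_prop

/-- The identification of `ℝ³` with `ℝ² × ℝ` by projection to the plane and height. -/
noncomputable def planeHeightHomeomorph : R3 ≃ₜ EuclideanSpace ℝ (Fin 2) × ℝ where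
  toFun v := (planeProj v, height v)
  invFun q := !₂[q.1 0, q.1 1, q.2]
  left_inv v := R3.ext_planeProj_height (by ext i; fin_cases i <;> simp [planeProj])
    (by simp [height])
  right_inv q := by
    refine Prod.ext ?_ (by simp [height])
    ext i
    fin_cases i <;> simp [planeProj]
  continuous_toFun := continuous_planeProj.prodMk continuous_height
  continuous_invFun := by
    refine (PiLp.continuous_toLp 2 _).comp (continuous_pi fun i => ?_)
    fin_cases i
    · exact (by fun_prop : Continuous fun q : EuclideanSpace ℝ (Fin 2) × ℝ => q.1 0)
    · exact (by fun_prop : Continuous fun q : EuclideanSpace ℝ (Fin 2) × ℝ => q.1 1)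
    · exact continuous_snd

theorem planeProj_tildeMap (f : ℝ → ℝ) (v : R3) : planeProj (tildeMap f v) = planeProj v := by
  simp [planeProj, tildeMap]

theorem height_tildeMap (f : ℝ → ℝ) (v : R3) : height (tildeMap f v) = f (height v) := by
  simp [height, tildeMap]

theorem tildeMap_iterate (f : ℝ → ℝ) (n : ℕ) : (tildeMap f)^[n] = tildeMap (f^[n]) := by
  induction n with
  | zero => funext v; exact R3.ext_planeProj_height (by simp [planeProj_tildeMap])
              (by simp [height_tildeMap])
  | succ n ih =>
    funext v
    rw [Function.iterate_succ_apply', ih]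
    exact R3.ext_planeProj_height (by simp [planeProj_tildeMap])
      (by simp only [height_tildeMap, Function.iterate_succ_apply'])

theorem planeProj_iterate_tildeMap (f : ℝ → ℝ) (n : ℕ) (v : R3) :
    planeProj ((tildeMap f)^[n] v) = planeProj v := by
  rw [tildeMap_iterate, planeProj_tildeMap]

/-! ### The vertical isotopy -/

namespace OrientedKnot

/-- If `tildeMap g` preserves the vertical order of the points of `k` over each point of the plane,
then `k` is ambient isotopic to its image: the straight-line isotopy along vertical lines extends to
all of `ℝ³`. -/
theorem ambientIsotopic_of_toFun_eq_tildeMap {k k' : OrientedKnot} {g : ℝ → ℝ}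
    (hg : Continuous g) (hk : ∀ s, k'.toFun s = tildeMap g (k.toFun s))
    (hmono : ∀ u ∈ k.carrier, ∀ v ∈ k.carrier, planeProj u = planeProj v →
      height u < height v → g (height u) < g (height v)) : AmbientIsotopic k k' := by
  let e := planeHeightHomeomorph
  have hcomp : IsCompact (e '' k.carrier) :=
    (isCompact_range k.continuous_toFun).image e.continuous
  obtain ⟨H, hH, hHm, hHs, hHK⟩ := exists_fiberwise_strictMono_extension hcomp
    ((range_nonempty k.toFun).image e) (φ := fun q => g q.1.2) (by fun_prop) (by
      rintro ⟨_, u, hu, rfl⟩ ⟨_, v, hv, rfl⟩ h1 h2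
      exact hmono u hu v hv h1 h2)
  let T : unitInterval → EuclideanSpace ℝ (Fin 2) × ℝ → ℝ := fun t q =>
    (1 - (t : ℝ)) * q.2 + t * H q
  have hT : Continuous fun x : unitInterval × (EuclideanSpace ℝ (Fin 2) × ℝ) => T x.1 x.2 := by
    fun_prop
  have hTt : ∀ t, Continuous (T t) := fun t => hT.comp (Continuous.prodMk_right t)
  have hTm : ∀ t w, StrictMono fun z => T t (w, z) := by
    intro t w z₁ z₂ hz
    have h := hHm w hz
    simp only [T] at h ⊢
    rcases t.2.1.eq_or_lt with ht | ht
    · simpa [← ht] using hz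
    · exact add_lt_add_of_le_of_lt (mul_le_mul_of_nonneg_left hz.le (sub_nonneg.2 t.2.2))
        (mul_lt_mul_of_pos_left h ht)
  have hTs : ∀ t w, Function.Surjective fun z => T t (w, z) := by
    intro t w y
    -- `y` lies between the values at the points where `z` and `H (w, z)` equal `y`
    obtain ⟨z₁, hz₁⟩ := hHs w y
    have h1 : min y z₁ ≤ max y z₁ := min_le_max
    have hc : ContinuousOn (fun z => T t (w, z)) (Icc (min y z₁) (max y z₁)) :=
      ((hTt t).comp (Continuous.prodMk_right w)).continuousOn
    have hlo : T t (w, min y z₁) ≤ y := by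
      have h2 : H (w, min y z₁) ≤ y := ((hHm w).monotone (min_le_right _ _)).trans_eq hz₁
      have h3 := mul_le_mul_of_nonneg_left (min_le_left y z₁) (sub_nonneg.2 t.2.2)
      have h4 := mul_le_mul_of_nonneg_left h2 t.2.1
      simp only [T]
      linarith
    have hhi : y ≤ T t (w, max y z₁) := by
      have h2 : y ≤ H (w, max y z₁) := hz₁.symm.trans_le ((hHm w).monotone (le_max_right _ _))
      have h3 := mul_le_mul_of_nonneg_left (le_max_left y z₁) (sub_nonneg.2 t.2.2)
      have h4 := mul_le_mul_of_nonneg_left h2 t.2.1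
      simp only [T]
      linarith
    obtain ⟨z, -, hz⟩ := intermediate_value_Icc h1 hc ⟨hlo, hhi⟩
    exact ⟨z, hz⟩
  refine ⟨fun t => (e.trans (fiberwiseHomeomorph (T t) (hTt t) (hTm t) (hTs t))).trans e.symm,
    ?_, fun v => ?_, OrderIso.refl ℝ, fun _ => rfl, fun s => ?_⟩
  · change Continuous fun q : unitInterval × R3 => e.symm ((e q.2).1, T q.1 (e q.2))
    have h2 : Continuous fun q : unitInterval × R3 => T q.1 (e q.2) :=
      hT.comp (continuous_fst.prodMk (e.continuous.comp continuous_snd))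
    fun_prop
  · change e.symm ((e v).1, T 0 (e v)) = v
    simp [T]
  · change e.symm ((e (k.toFun s)).1, T 1 (e (k.toFun s))) = k'.toFun s
    rw [Homeomorph.symm_apply_eq, hk]
    refine Prod.ext (planeProj_tildeMap _ _).symm ?_
    have h := hHK ⟨e (k.toFun s), k.toFun s, mem_range_self _, rfl⟩
    have h' : (e (tildeMap g (k.toFun s))).2 = g (height (k.toFun s)) := height_tildeMap _ _
    rw [h']
    simp only [T, h]
    simp [e, planeHeightHomeomorph]

end OrientedKnot

/-! ### Images of polygonal sets -/

theorem exists_segment_eq_segment_inter {E : Type*} [AddCommGroup E] [Module ℝ E]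
    [TopologicalSpace E] [IsTopologicalAddGroup E] [ContinuousSMul ℝ E] (a b : E) {C : Set E}
    (hC : IsClosed C) (hconv : Convex ℝ C) (hne : (segment ℝ a b ∩ C).Nonempty) :
    ∃ c d : E, segment ℝ c d = segment ℝ a b ∩ C := by
  let l : ℝ →ᵃ[ℝ] E := AffineMap.lineMap a b
  have hl : Continuous l := AffineMap.lineMap_continuous
  have heq : segment ℝ a b ∩ C = l '' (Icc 0 1 ∩ l ⁻¹' C) := by
    rw [image_inter_preimage, segment_eq_image_lineMap]
  have hTne : (Icc 0 1 ∩ l ⁻¹' C).Nonempty := by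
    rw [heq] at hne
    exact hne.of_image
  have hTc : IsCompact (Icc 0 1 ∩ l ⁻¹' C) := isCompact_Icc.inter_right (hC.preimage hl)
  have hTconv : Convex ℝ (Icc 0 1 ∩ l ⁻¹' C) := (convex_Icc 0 1).inter (hconv.affine_preimage l)
  have hT := eq_Icc_of_connected_compact ⟨hTne, hTconv.isPreconnected⟩ hTc
  refine ⟨l (sInf (Icc 0 1 ∩ l ⁻¹' C)), l (sSup (Icc 0 1 ∩ l ⁻¹' C)), ?_⟩
  have hle : sInf (Icc 0 1 ∩ l ⁻¹' C) ≤ sSup (Icc 0 1 ∩ l ⁻¹' C) := by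
    rw [hT] at hTne
    exact nonempty_Icc.1 hTne
  rw [heq, hT, ← segment_eq_Icc hle, image_segment]
  rw [segment_eq_Icc hle, ← hT]

/-- A finite union of straight line segments, so that a knot is polygonal when its carrier is such
a set. Single points are the segments with equal endpoints. -/
def IsPolygonalSet (A : Set R3) : Prop :=
  ∃ S : Finset (R3 × R3), A = ⋃ e ∈ S, segment ℝ e.1 e.2

theorem isPolygonalSet_segment (a b : R3) : IsPolygonalSet (segment ℝ a b) :=
  ⟨{(a, b)}, by simp⟩

theorem isPolygonalSet_biUnion {ι : Type*} {s : Set ι} (hs : s.Finite) {A : ι → Set R3}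
    (h : ∀ i ∈ s, IsPolygonalSet (A i)) : IsPolygonalSet (⋃ i ∈ s, A i) := by
  classical
  choose! S hS using h
  refine ⟨hs.toFinset.biUnion S, ?_⟩
  rw [Finset.set_biUnion_biUnion]
  simp only [Finite.mem_toFinset]
  exact iUnion₂_congr hS

/-- The map `(x, y, z) ↦ (x, y, α z + β)` as an affine map. -/
noncomputable def tildeAffine (α β : ℝ) : R3 →ᵃ[ℝ] R3 where
  toFun := tildeMap fun z => α * z + β
  linear :=
    { toFun := fun v => !₂[v 0, v 1, α * v 2]
      map_add' := fun u v => by ext i; fin_cases i <;> simp [mul_add]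
      map_smul' := fun c v => by ext i; fin_cases i <;> simp [mul_left_comm] }
  map_vadd' p v := by ext i; fin_cases i <;> simp [tildeMap]; ring

theorem IsPolygonalSet.image_tildeMap {f : ℝ → ℝ} (hf : IsPiecewiseLinear f) {A : Set R3}
    (hA : IsPolygonalSet A) : IsPolygonalSet (tildeMap f '' A) := by
  obtain ⟨S, rfl⟩ := hA
  rw [image_iUnion₂]
  refine isPolygonalSet_biUnion S.finite_toSet fun e _ => ?_
  obtain ⟨Λ, I, hI, hU, h⟩ := hf
  have hcomp : IsCompact (segment ℝ e.1 e.2) := by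
    rw [segment_eq_image_lineMap]
    exact isCompact_Icc.image AffineMap.lineMap_continuous
  have hfin := hI.finite_nonempty_inter_compact (hcomp.image continuous_height)
  -- Only finitely many of the intervals on which `f` is affine meet the heights of the segment, and
  -- each of them cuts out a subsegment.
  have heq : segment ℝ e.1 e.2 = ⋃ l ∈ {l | (I l ∩ height '' segment ℝ e.1 e.2).Nonempty},
      segment ℝ e.1 e.2 ∩ height ⁻¹' I l := by
    refine Subset.antisymm (fun v hv => ?_) (iUnion₂_subset fun l _ => inter_subset_left)
    obtain ⟨l, hl⟩ := mem_iUnion.1 (hU ▸ mem_univ (height v))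
    exact mem_iUnion₂.2 ⟨l, ⟨_, hl, v, hv, rfl⟩, hv, hl⟩
  rw [heq, image_iUnion₂]
  refine isPolygonalSet_biUnion hfin fun l hl => ?_
  obtain ⟨hcl, hord, α, β, hαβ⟩ := h l
  have hconv : Convex ℝ (height ⁻¹' I l) :=
    hord.convex.linear_preimage (EuclideanSpace.proj (2 : Fin 3) : R3 →L[ℝ] ℝ).toLinearMap
  obtain ⟨_, hl, v, hv, rfl⟩ := hl
  obtain ⟨c, d, hcd⟩ := exists_segment_eq_segment_inter e.1 e.2
    (hcl.preimage continuous_height) hconv ⟨v, hv, hl⟩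
  have himg : tildeMap f '' (segment ℝ e.1 e.2 ∩ height ⁻¹' I l) =
      segment ℝ (tildeAffine α β c) (tildeAffine α β d) := by
    rw [← image_segment, hcd]
    refine image_congr fun u hu => ?_
    change tildeMap f u = tildeMap (fun z => α * z + β) u
    refine R3.ext_planeProj_height ?_ ?_
    · rw [planeProj_tildeMap, planeProj_tildeMap]
    · rw [height_tildeMap, height_tildeMap, hαβ _ hu.2]
  rw [himg]
  exact isPolygonalSet_segment _ _

theorem IsPolygonalSet.image_iterate_tildeMap {f : ℝ → ℝ} (hf : IsPiecewiseLinear f) {A : Set R3}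
    (hA : IsPolygonalSet A) (n : ℕ) : IsPolygonalSet ((tildeMap f)^[n] '' A) := by
  induction n with
  | zero => simpa using hA
  | succ n ih =>
    rw [Function.iterate_succ', image_comp]
    exact ih.image_tildeMap hf

/-! ### Controlling pairs -/

/-- Removing the diagonal from the pairs of points with equal projection in two given segments
leaves two convex pieces, according to which of the two points is higher. -/
theorem IsPolygonalSet.exists_finite_convex_cover {A : Set R3} (hA : IsPolygonalSet A) :
    ∃ (a : ℕ) (C : Fin a → Set (R3 × R3)), (∀ i, Convex ℝ (C i)) ∧ (∀ i, (C i).Nonempty) ∧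
      (⋃ i, C i) = {q | q.1 ∈ A ∧ q.2 ∈ A ∧ q.1 ≠ q.2 ∧ planeProj q.1 = planeProj q.2} := by
  obtain ⟨S, rfl⟩ := hA
  let D : S × S × ℤˣ → Set (R3 × R3) := fun i =>
    {q | q.1 ∈ segment ℝ i.1.1.1 i.1.1.2 ∧ q.2 ∈ segment ℝ i.2.1.1.1 i.2.1.1.2 ∧
      planeProj q.1 = planeProj q.2 ∧ 0 < ((i.2.2 : ℤ) : ℝ) * (height q.1 - height q.2)}
  have hD : ∀ i, Convex ℝ (D i) := by
    intro i
    have h1 : Convex ℝ {q : R3 × R3 | planeProj q.1 = planeProj q.2} := by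
      intro q hq r hr s t _ _ _
      have hq' := fun j => congrArg (fun w => w j) hq
      have hr' := fun j => congrArg (fun w => w j) hr
      change planeProj _ = planeProj _
      ext j
      have h2 := hq' j
      have h3 := hr' j
      fin_cases j <;> simp [planeProj] at h2 h3 ⊢ <;> rw [h2, h3]
    have h2 : Convex ℝ {q : R3 × R3 | 0 < ((i.2.2 : ℤ) : ℝ) * (height q.1 - height q.2)} := by
      intro q hq r hr s t hs ht hst
      have h := convex_Ioi (0 : ℝ) hq hr hs ht hst
      simp only [smul_eq_mul, mem_Ioi] at h
      change 0 < ((i.2.2 : ℤ) : ℝ) *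
        (height (s • q.1 + t • r.1) - height (s • q.2 + t • r.2))
      refine h.trans_eq ?_
      simp [height]
      ring
    exact ((convex_segment _ _).linear_preimage (LinearMap.fst ℝ R3 R3)).inter
      (((convex_segment _ _).linear_preimage (LinearMap.snd ℝ R3 R3)).inter (h1.inter h2))
  have hU : (⋃ i, D i) = {q | q.1 ∈ (⋃ e ∈ S, segment ℝ e.1 e.2) ∧
      q.2 ∈ (⋃ e ∈ S, segment ℝ e.1 e.2) ∧ q.1 ≠ q.2 ∧ planeProj q.1 = planeProj q.2} := by
    ext q
    simp only [mem_iUnion, mem_ofPred_eq]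
    constructor
    · rintro ⟨⟨e, e', s⟩, h1, h2, h3, h4⟩
      refine ⟨⟨e, e.2, h1⟩, ⟨e', e'.2, h2⟩, fun h => ?_, h3⟩
      simp [h] at h4
    · rintro ⟨⟨e, he, h1⟩, ⟨e', he', h2⟩, h3, h4⟩
      rcases lt_trichotomy (height q.1) (height q.2) with h | h | h
      · exact ⟨⟨⟨e, he⟩, ⟨e', he'⟩, -1⟩, h1, h2, h4, by simpa using h⟩
      · exact absurd (R3.ext_planeProj_height h4 h) h3
      · exact ⟨⟨⟨e, he⟩, ⟨e', he'⟩, 1⟩, h1, h2, h4, by simpa using h⟩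
  obtain ⟨a, ⟨φ⟩⟩ := Finite.exists_equiv_fin {i // (D i).Nonempty}
  refine ⟨a, fun i => D (φ.symm i), fun i => hD _, fun i => (φ.symm i).2, ?_⟩
  rw [← hU]
  refine Subset.antisymm (iUnion_subset fun i => subset_iUnion D _) (iUnion_subset fun i q hq => ?_)
  exact mem_iUnion.2 ⟨φ ⟨i, q, hq⟩, by simpa using hq⟩

theorem IsPreconnected.mul_pos_of_ne_zero {X : Type*} [TopologicalSpace X] {C : Set X}
    (hC : IsPreconnected C) {ψ : X → ℝ} (hψ : ContinuousOn ψ C) (h0 : ∀ q ∈ C, ψ q ≠ 0)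
    {q r : X} (hq : q ∈ C) (hr : r ∈ C) : 0 < ψ q * ψ r := by
  by_contra h
  have hord := (hC.image ψ hψ).ordConnected
  have h0' : (0 : ℝ) ∉ ψ '' C := by
    rintro ⟨s, hs, hs0⟩
    exact h0 s hs hs0
  rcases mul_nonpos_iff.1 (not_lt.1 h) with ⟨h1, h2⟩ | ⟨h1, h2⟩
  · exact h0' (hord.out ⟨r, hr, rfl⟩ ⟨q, hq, rfl⟩ ⟨h2, h1⟩)
  · exact h0' (hord.out ⟨q, hq, rfl⟩ ⟨r, hr, rfl⟩ ⟨h1, h2⟩)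

theorem height_iterate_sub_ne_zero {f : ℝ → ℝ} {A : Set R3}
    (hinj : IterativelyInjective (tildeMap f) A) (n : ℕ) {u v : R3} (hu : u ∈ A) (hv : v ∈ A)
    (huv : u ≠ v) (hp : planeProj u = planeProj v) :
    height ((tildeMap f)^[n] u) - height ((tildeMap f)^[n] v) ≠ 0 := fun h =>
  huv (hinj n hu hv (R3.ext_planeProj_height
    (by rw [planeProj_iterate_tildeMap, planeProj_iterate_tildeMap, hp]) (sub_eq_zero.1 h)))

/-- One pair from each convex piece of the set of crossings controls the crossings, since the sign
of the height difference of the `j`-th iterates is constant on each piece. -/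
theorem IsPolygonalSet.exists_controlsCrossings {f : ℝ → ℝ} (hf : Continuous f) {A : Set R3}
    (hA : IsPolygonalSet A) (hinj : IterativelyInjective (tildeMap f) A) :
    ∃ (a : ℕ) (x y : Fin a → R3), ControlsCrossings (tildeMap f) A x y := by
  obtain ⟨a, C, hC, hne, hU⟩ := hA.exists_finite_convex_cover
  choose q hq using hne
  have hmem : ∀ i, ∀ r ∈ C i,
      r.1 ∈ A ∧ r.2 ∈ A ∧ r.1 ≠ r.2 ∧ planeProj r.1 = planeProj r.2 := fun i r hr =>
    hU.subset (mem_iUnion.2 ⟨i, hr⟩)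
  refine ⟨a, fun i => (q i).1, fun i => (q i).2, fun i => hmem i _ (hq i), ?_⟩
  rintro m n hmn hs _ ⟨u, hu, rfl⟩ _ ⟨v, hv, rfl⟩ hne hp
  rw [planeProj_iterate_tildeMap, planeProj_iterate_tildeMap] at hp
  obtain ⟨i, hi⟩ := mem_iUnion.1 (hU.superset
    (show (u, v) ∈ {q : R3 × R3 | _} from ⟨hu, hv, fun h => hne (congrArg _ h), hp⟩))
  rw [← Function.iterate_add_apply, ← Function.iterate_add_apply, Nat.sub_add_cancel hmn]
  have key : ∀ j, 0 < (height ((tildeMap f)^[j] u) - height ((tildeMap f)^[j] v)) *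
      (height ((tildeMap f)^[j] (q i).1) - height ((tildeMap f)^[j] (q i).2)) := by
    intro j
    have hc : Continuous fun x => height ((tildeMap f)^[j] x) :=
      continuous_height.comp ((continuous_tildeMap hf).iterate j)
    have hψ : Continuous fun r : R3 × R3 =>
        height ((tildeMap f)^[j] r.1) - height ((tildeMap f)^[j] r.2) :=
      (hc.comp continuous_fst).sub (hc.comp continuous_snd)
    exact (hC i).isPreconnected.mul_pos_of_ne_zero hψ.continuousOn (fun r hr =>
      have h := hmem i r hr
      height_iterate_sub_ne_zero hinj j h.1 h.2.1 h.2.2.1 h.2.2.2) hi (hq i)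
  -- multiply the three sign agreements; the contribution of the chosen pair is a square
  have h1 := mul_pos (mul_pos (key m) (key n)) (hs i)
  refine pos_of_mul_pos_left (b := ((height ((tildeMap f)^[m] (q i).1) -
    height ((tildeMap f)^[m] (q i).2)) * (height ((tildeMap f)^[n] (q i).1) -
    height ((tildeMap f)^[n] (q i).2))) ^ 2) ?_ (sq_nonneg _)
  refine h1.trans_eq ?_
  ring

namespace OrientedKnot

theorem carrier_iterImage (k : OrientedKnot) (F : R3 → R3) (hF : Continuous F)
    (hk : IterativelyInjective F k.carrier) (n : ℕ) :
    (k.iterImage F hF hk n).carrier = F^[n] '' k.carrier :=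
  range_comp (F^[n]) k.toFun

/-- Iterates in which the controlling pairs have the same signs of height differences are ambient
isotopic. -/
theorem ambientIsotopic_iterImage {f : ℝ → ℝ} (hf : Continuous f) {k : OrientedKnot}
    (hinj : IterativelyInjective (tildeMap f) k.carrier) {a : ℕ} {x y : Fin a → R3}
    (hc : ControlsCrossings (tildeMap f) k.carrier x y) {m n : ℕ} (hmn : m ≤ n)
    (hs : ∀ i, 0 < (height ((tildeMap f)^[m] (x i)) - height ((tildeMap f)^[m] (y i))) *
      (height ((tildeMap f)^[n] (x i)) - height ((tildeMap f)^[n] (y i)))) :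
    AmbientIsotopic (k.iterImage (tildeMap f) (continuous_tildeMap hf) hinj m)
      (k.iterImage (tildeMap f) (continuous_tildeMap hf) hinj n) := by
  refine ambientIsotopic_of_toFun_eq_tildeMap (hf.iterate (n - m)) (fun s => ?_) ?_
  · change (tildeMap f)^[n] (k.toFun s) = tildeMap _ ((tildeMap f)^[m] (k.toFun s))
    rw [← tildeMap_iterate, ← Function.iterate_add_apply, Nat.sub_add_cancel hmn]
  · rw [carrier_iterImage]
    intro u hu v hv hp hlt
    have h := hc.2 m n hmn hs u hu v hv (fun h => hlt.ne (congrArg _ h)) hp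
    rw [tildeMap_iterate, height_tildeMap, height_tildeMap] at h
    exact sub_neg.1 (neg_of_mul_pos_right h (sub_neg.2 hlt).le)

end OrientedKnot

/-! ### Finiteness of the set of knot types -/

theorem mainTheorem6 (f : ℝ → ℝ) (hf : IsPiecewiseLinear f) (k : OrientedKnot)
    (hk : k.IsPolygonal) (hinj : IterativelyInjective (tildeMap f) k.carrier) :
    (∀ n : ℕ, (k.iterImage (tildeMap f) (continuous_tildeMap hf.continuous) hinj n).IsPolygonal) ∧
    (∃ (a : ℕ) (x y : Fin a → R3), ControlsCrossings (tildeMap f) k.carrier x y) ∧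
    ∀ (a : ℕ) (x y : Fin a → R3), ControlsCrossings (tildeMap f) k.carrier x y →
      ∃ J : Finset KnotType, (J : Set KnotType) ⊆ tameKnotTypes ∧ J.card ≤ 2 ^ a ∧
        ∀ n : ℕ,
          (k.iterImage (tildeMap f) (continuous_tildeMap hf.continuous) hinj n).knotType ∈ J := by
  classical
  have hpoly : ∀ n : ℕ,
      (k.iterImage (tildeMap f) (continuous_tildeMap hf.continuous) hinj n).IsPolygonal := by
    intro n
    have h := IsPolygonalSet.image_iterate_tildeMap hf hk n
    rwa [← OrientedKnot.carrier_iterImage k _ (continuous_tildeMap hf.continuous) hinj] at h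
  refine ⟨hpoly, IsPolygonalSet.exists_controlsCrossings hf.continuous hk hinj,
    fun a x y hc => ?_⟩
  let K : ℕ → KnotType := fun n =>
    (k.iterImage (tildeMap f) (continuous_tildeMap hf.continuous) hinj n).knotType
  let ψ : ℕ → Fin a → ℝ := fun n i =>
    height ((tildeMap f)^[n] (x i)) - height ((tildeMap f)^[n] (y i))
  have hψ : ∀ n i, ψ n i ≠ 0 := fun n i =>
    have h := hc.1 i
    height_iterate_sub_ne_zero hinj n h.1 h.2.1 h.2.2.1 h.2.2.2
  -- The sign vector of the controlling pairs determines the knot type.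
  let σ : ℕ → Fin a → Bool := fun n i => decide (0 < ψ n i)
  have hσ : ∀ m n, m ≤ n → σ m = σ n → K m = K n := by
    intro m n hmn h
    refine Quotient.sound (OrientedKnot.ambientIsotopic_iterImage hf.continuous hinj hc hmn ?_)
    intro i
    have hi : 0 < ψ m i ↔ 0 < ψ n i := decide_eq_decide.1 (congrFun h i)
    change 0 < ψ m i * ψ n i
    rcases lt_or_gt_of_ne (hψ m i) with h1 | h1
    · exact mul_pos_of_neg_of_neg h1
        ((hψ n i).lt_of_le (not_lt.1 fun h2 => h1.not_gt (hi.2 h2)))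
    · exact mul_pos h1 (hi.1 h1)
  have hσ' : ∀ m n, σ m = σ n → K m = K n := fun m n h =>
    (le_total m n).elim (fun hmn => hσ m n hmn h) fun hnm => (hσ n m hnm h.symm).symm
  -- For a vector `s` that is not attained, `invFun σ s` is still some iterate, so every element of
  -- the image is the type of a polygonal knot.
  refine ⟨Finset.univ.image fun s => K (Function.invFun σ s), ?_, ?_, fun n => ?_⟩
  · intro T hT
    obtain ⟨s, -, rfl⟩ := Finset.mem_image.1 (Finset.mem_coe.1 hT)
    exact ⟨_, hpoly _, rfl⟩
  · exact Finset.card_image_le.trans (by simp)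
  · exact Finset.mem_image.2 ⟨σ n, Finset.mem_univ _, hσ' _ _ (Function.invFun_eq ⟨n, rfl⟩)⟩
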